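/- Let $R$ be a commutative local Artinian ring (finite or infinite, not necessarily Frobenius), let $n \ge 0$, and let $C \subseteq R^n$ be an $R$-linear code, that is, an $R$-submodule of $R^n$. Write $$C^\perp = \{v \in R^n \mid v_1 w_1 + \cdots + v_n w_n = 0 \text{ for all } w \in C\}$$ for its orthogonal code, and let $\lambda$ denote the length of an $R$-module. For a nonzero code $D \subseteq R^n$ let $d_H(D)$ be the minimum of the Hamming weights $|\{i \mid v_i \ne 0\}|$ of the nonzero elements $v \in D$; for the zero code put $d_H(0) = n+1$. A code $D \subseteq R^n$ is called MDS if it attains the Singleton-type bound $d_H(D) \le n - \frac{\lambda(D)}{\lambda(R)} + 1$, that is, if $$d_H(D) = n - \frac{\lambda(D)}{\lambda(R)} + 1.$$ Then $C$ is MDS if and only if $C^\perp$ is MDS. -/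

import Mathlib

noncomputable section

namespace LinearCode

variable {R : Type*} [CommRing R] {n : ℕ}

/-- The orthogonal code of `C ⊆ R ^ n` with respect to the dot product:
all `v` in `R ^ n` with `v ⬝ w = 0` for every `w ∈ C`. -/
def dual (C : Submodule R (Fin n → R)) : Submodule R (Fin n → R) where
  carrier := {v | ∀ w ∈ C, v ⬝ᵥ w = 0}
  add_mem' := by
    intro a b ha hb w hw
    rw [add_dotProduct, ha w hw, hb w hw, add_zero]
  zero_mem' := by
    intro w _
    exact zero_dotProduct w
  smul_mem' := by
    intro c a ha w hw
    rw [smul_dotProduct, ha w hw, smul_zero]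

open scoped Classical in
/-- The minimum distance of a code `C ⊆ R ^ n`: the least Hamming weight of a nonzero element of
`C` when `C ≠ 0`, and, by convention, `n + 1` for the zero code. -/
def minDist (C : Submodule R (Fin n → R)) : ℕ :=
  if C = ⊥ then n + 1 else sInf {k : ℕ | ∃ v ∈ C, v ≠ 0 ∧ hammingNorm v = k}

/-- The length `λ(M)` of a module of finite length, as a natural number. Over an Artinian ring all
codes, and the ring itself, have finite length. -/
def len (R : Type*) [CommRing R] (M : Type*) [AddCommGroup M] [Module R M] : ℕ :=
  (Module.length R M).toNat

/-- A code `C ⊆ R ^ n` is MDS if it attains the bound `d(C) ≤ n - λ(C) / λ(R) + 1`; the division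
is the exact one in `ℚ`. -/
def IsMDS (C : Submodule R (Fin n → R)) : Prop :=
  (minDist C : ℚ) = (n : ℚ) - (len R C : ℚ) / (len R R : ℚ) + 1

end LinearCode

end

noncomputable section

namespace LinearCode

variable {R : Type*} [CommRing R] {n : ℕ}

/-! MDS codes are those for which, for one `k`, every `k` coordinates form an information set
(`isMDS_iff`); such a code is free, with restriction an isomorphism onto `R ^ S`. Complements of
information sets of `C` are information sets of `dual C`, so MDS passes to the dual over any
nontrivial Artinian ring. Without a Frobenius hypothesis `dual (dual C) = C` can fail, so the
converse needs more. If `dual C` is MDS, so is the double dual `E`, whose functionals are therefore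
dot products. Were `C` smaller than `E`, a nonzero functional on `E / C` would be a dot product with
some `u` in `dual C`, and such a `u` kills `E`: a contradiction. -/

theorem le_dual_dual (C : Submodule R (Fin n → R)) : C ≤ dual (dual C) := by
  intro v hv w hw
  rw [dotProduct_comm]
  exact hw v hv

/-- `S` is an information set of `C` if restricting codewords to the coordinates in `S` is a
bijection from `C` to `R ^ S`. -/
structure IsInformationSet (C : Submodule R (Fin n → R)) (S : Finset (Fin n)) : Prop where
  eq_zero : ∀ v ∈ C, (∀ i ∈ S, v i = 0) → v = 0
  exists_mem : ∀ u : Fin n → R, ∃ v ∈ C, ∀ i ∈ S, v i = u i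

/-- The restriction of the codewords of `C` to the coordinates in `S`. -/
def restrict (C : Submodule R (Fin n → R)) (S : Finset (Fin n)) : C →ₗ[R] (S → R) :=
  LinearMap.funLeft R R (Subtype.val : S → Fin n) ∘ₗ C.subtype

@[simp]
theorem restrict_apply (C : Submodule R (Fin n → R)) (S : Finset (Fin n)) (v : C) (i : S) :
    restrict C S v i = (v : Fin n → R) i :=
  rfl

theorem restrict_injective_iff {C : Submodule R (Fin n → R)} {S : Finset (Fin n)} :
    Function.Injective (restrict C S) ↔ ∀ v ∈ C, (∀ i ∈ S, v i = 0) → v = 0 := by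
  rw [injective_iff_map_eq_zero]
  simp only [funext_iff, Subtype.forall, restrict_apply, Pi.zero_apply, Submodule.mk_eq_zero]

theorem restrict_surjective_iff {C : Submodule R (Fin n → R)} {S : Finset (Fin n)} :
    Function.Surjective (restrict C S) ↔ ∀ u : Fin n → R, ∃ v ∈ C, ∀ i ∈ S, v i = u i := by
  constructor
  · intro h u
    obtain ⟨v, hv⟩ := h fun i => u i
    exact ⟨v, v.2, fun i hi => congrFun hv ⟨i, hi⟩⟩
  · intro h u
    obtain ⟨v, hv, hvu⟩ := h fun i => if hi : i ∈ S then u ⟨i, hi⟩ else 0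
    refine ⟨⟨v, hv⟩, funext fun i => ?_⟩
    simp [hvu i i.2]

theorem isInformationSet_iff_bijective {C : Submodule R (Fin n → R)} {S : Finset (Fin n)} :
    IsInformationSet C S ↔ Function.Bijective (restrict C S) := by
  rw [Function.Bijective, restrict_injective_iff, restrict_surjective_iff]
  exact ⟨fun h => ⟨h.1, h.2⟩, fun h => ⟨h.1, h.2⟩⟩

theorem len_pi (R : Type*) [CommRing R] {ι : Type*} [Fintype ι] :
    len R (ι → R) = Fintype.card ι * len R R := by
  simp [len]

theorem IsInformationSet.len_eq {C : Submodule R (Fin n → R)} {S : Finset (Fin n)}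
    (h : IsInformationSet C S) : len R C = S.card * len R R := by
  have := (LinearEquiv.ofBijective _ (isInformationSet_iff_bijective.1 h)).length_eq
  rw [len, this, ← len, len_pi, Fintype.card_coe]

/-- An injective linear map between modules of the same finite length is surjective. -/
theorem surjective_of_injective_of_length_eq {M N : Type*} [AddCommGroup M] [AddCommGroup N]
    [Module R M] [Module R N] [IsArtinian R N] [IsNoetherian R N] (f : M →ₗ[R] N)
    (hf : Function.Injective f) (h : Module.length R M = Module.length R N) :
    Function.Surjective f := by
  rw [← LinearMap.range_eq_top]
  by_contra hr
  have := Submodule.length_lt hr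
  rw [← (LinearEquiv.ofInjective f hf).length_eq, h] at this
  exact this.false

theorem isInformationSet_of_len_eq [IsArtinianRing R] {C : Submodule R (Fin n → R)}
    {S : Finset (Fin n)} (hS : ∀ v ∈ C, (∀ i ∈ S, v i = 0) → v = 0)
    (h : len R C = S.card * len R R) : IsInformationSet C S := by
  have hinj := restrict_injective_iff.2 hS
  refine isInformationSet_iff_bijective.2
    ⟨hinj, surjective_of_injective_of_length_eq _ hinj ?_⟩
  rw [← Fintype.card_coe, ← len_pi] at h
  rw [← ENat.natCast_toNat (Module.length_ne_top (R := R) (M := C)),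
    ← ENat.natCast_toNat (Module.length_ne_top (R := R) (M := S → R))]
  exact congrArg _ h

/-- Every linear functional on `C` is the dot product with a vector supported on a given
information set. -/
theorem IsInformationSet.exists_dotProduct {C : Submodule R (Fin n → R)} {S : Finset (Fin n)}
    (h : IsInformationSet C S) (f : C →ₗ[R] R) :
    ∃ u : Fin n → R, (∀ i ∉ S, u i = 0) ∧ ∀ w : C, f w = u ⬝ᵥ (w : Fin n → R) := by
  -- The codewords `e i`, for `i ∈ S`, form the basis of `C` that restricts to the standard basis of
  -- `R ^ S`.
  choose e heC he using fun i => h.exists_mem (Pi.single i 1)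
  refine ⟨fun i => if i ∈ S then f ⟨e i, heC i⟩ else 0, fun i hi => if_neg hi, fun w => ?_⟩
  have hw : w = ∑ i ∈ S, (w : Fin n → R) i • (⟨e i, heC i⟩ : C) := by
    rw [← sub_eq_zero]
    refine Subtype.ext (h.eq_zero _ (Subtype.property _) fun j hj => ?_)
    simp +contextual [he _ _ hj, Pi.single_apply, hj]
  conv_lhs => rw [hw]
  simp only [map_sum, map_smul]
  simp [dotProduct, mul_comm, Finset.sum_ite_mem]

/-- Pairing with the codeword that is a unit vector on `S` expresses each `v i`, `i ∈ S`, through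
the entries off `S`. Conversely, entries prescribed off `S` define a functional on `C`, whose
negative is the dot product with a vector supported on `S`; adding that vector gives a word of the
dual. -/
theorem IsInformationSet.dual_compl {C : Submodule R (Fin n → R)} {S : Finset (Fin n)}
    (h : IsInformationSet C S) : IsInformationSet (dual C) Sᶜ where
  eq_zero v hv hv0 := by
    funext i
    by_cases hi : i ∈ S
    · obtain ⟨w, hw, hwi⟩ := h.exists_mem (Pi.single i 1)
      have hvw := hv w hw
      rw [dotProduct, Finset.sum_eq_single i] at hvw
      · simpa [hwi i hi] using hvw
      · intro j _ hji
        by_cases hj : j ∈ S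
        · simp [hwi j hj, hji]
        · simp [hv0 j (Finset.mem_compl.2 hj)]
      · simp
    · exact hv0 i (Finset.mem_compl.2 hi)
  exists_mem u := by
    let u' : Fin n → R := fun i => if i ∈ S then 0 else u i
    obtain ⟨x, hx0, hx⟩ := h.exists_dotProduct
      (-((dotProductBilin R R u') ∘ₗ C.subtype))
    refine ⟨u' + x, fun w hw => ?_, fun i hi => ?_⟩
    · have := hx ⟨w, hw⟩
      simp only [LinearMap.neg_apply, LinearMap.comp_apply, Submodule.subtype_apply,
        dotProductBilin_apply_apply] at this
      rw [add_dotProduct, ← this, add_neg_cancel]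
    · rw [Finset.mem_compl] at hi
      simp [u', hi, hx0 i hi]

theorem minDist_bot : minDist (⊥ : Submodule R (Fin n → R)) = n + 1 :=
  if_pos rfl

theorem minDist_le {C : Submodule R (Fin n → R)} {v : Fin n → R} [DecidableEq R] (hv : v ∈ C)
    (hv0 : v ≠ 0) : minDist C ≤ hammingNorm v := by
  have hC : C ≠ ⊥ := fun h => hv0 (by simpa [h] using hv)
  rw [minDist, if_neg hC]
  exact Nat.sInf_le ⟨v, hv, hv0, by congr!⟩

theorem exists_hammingNorm_eq_minDist [DecidableEq R] {C : Submodule R (Fin n → R)}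
    (hC : C ≠ ⊥) : ∃ v ∈ C, v ≠ 0 ∧ hammingNorm v = minDist C := by
  rw [minDist, if_neg hC]
  obtain ⟨w, hw, hw0⟩ := C.ne_bot_iff.1 hC
  obtain ⟨v, hv, hv0, h⟩ := Nat.sInf_mem (s := {k : ℕ | ∃ v ∈ C, v ≠ 0 ∧ hammingNorm v = k})
    ⟨_, w, hw, hw0, rfl⟩
  exact ⟨v, hv, hv0, by convert h⟩

theorem minDist_pos (C : Submodule R (Fin n → R)) : 0 < minDist C := by
  classical
  by_cases hC : C = ⊥
  · rw [hC, minDist_bot]; omega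
  · obtain ⟨v, -, hv0, h⟩ := exists_hammingNorm_eq_minDist hC
    rw [← h]
    exact hammingNorm_pos_iff.2 hv0

theorem minDist_le_succ (C : Submodule R (Fin n → R)) : minDist C ≤ n + 1 := by
  classical
  by_cases hC : C = ⊥
  · rw [hC, minDist_bot]
  · obtain ⟨v, -, -, h⟩ := exists_hammingNorm_eq_minDist hC
    have := hammingNorm_le_card_fintype (x := v)
    rw [Fintype.card_fin] at this
    omega

theorem hammingNorm_add_card_le [DecidableEq R] {v : Fin n → R} {S : Finset (Fin n)}
    (h : ∀ i ∈ S, v i = 0) : hammingNorm v + S.card ≤ n := by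
  have hd : Disjoint (Finset.univ.filter fun i => v i ≠ 0) S := by
    rw [Finset.disjoint_left]
    intro i hi hS
    exact (Finset.mem_filter.1 hi).2 (h i hS)
  have := Finset.card_le_univ ((Finset.univ.filter fun i => v i ≠ 0) ∪ S)
  rwa [Finset.card_union_of_disjoint hd, Fintype.card_fin] at this

/-- A code is MDS if and only if, for some `k`, every `k` coordinates form an information set. -/
theorem isMDS_iff [Nontrivial R] [IsArtinianRing R] {C : Submodule R (Fin n → R)} :
    IsMDS C ↔ ∃ k ≤ n, ∀ S : Finset (Fin n), S.card = k → IsInformationSet C S := by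
  classical
  have hR : (len R R : ℚ) ≠ 0 := by
    have h1 : Module.length R R ≠ 0 := Module.length_pos.ne'
    have h2 : Module.length R R ≠ ⊤ := Module.length_ne_top
    simp [len, h1, h2]
  have hpos := minDist_pos C
  have hle := minDist_le_succ C
  constructor
  · intro h
    -- A codeword vanishing on this many coordinates has weight below `minDist C`. The convention
    -- for the zero code gives `k = 0`.
    refine ⟨n + 1 - minDist C, by omega, fun S hS => isInformationSet_of_len_eq ?_ ?_⟩
    · intro v hv hv0
      by_contra hne
      have := minDist_le hv hne
      have := hammingNorm_add_card_le hv0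
      omega
    · rw [hS]
      rw [IsMDS] at h
      have : (len R C : ℚ) = (n + 1 - minDist C) * len R R := by
        rw [h]; field_simp; ring
      rw [← @Nat.cast_inj ℚ, this]
      push_cast [hle]
      rfl
  · rintro ⟨k, hk, h⟩
    obtain ⟨S, -, hS⟩ := Finset.exists_subset_card_eq (s := (Finset.univ : Finset (Fin n)))
      (n := k) (by simpa using hk)
    have key : minDist C + k = n + 1 := by
      by_cases hC : C = ⊥
      · have h0 := (h S hS).len_eq
        rw [hC, minDist_bot]
        rw [hC, hS, len, Module.length_bot] at h0
        have : k = 0 := by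
          rcases Nat.mul_eq_zero.1 h0.symm with h | h
          · exact h
          · exact absurd (by exact_mod_cast h) hR
        omega
      apply le_antisymm
      · obtain ⟨i, hi⟩ : S.Nonempty := by
          rw [Finset.nonempty_iff_ne_empty]
          rintro rfl
          exact hC (C.eq_bot_iff.2 fun v hv => (h _ hS).eq_zero v hv (by simp))
        -- A codeword that is a unit vector on `S` has at least `k - 1` zeros.
        obtain ⟨v, hv, hvi⟩ := (h S hS).exists_mem (Pi.single i 1)
        have h1 := minDist_le hv fun h0 => by simpa [h0] using hvi i hi
        have h2 := hammingNorm_add_card_le (v := v) (S := S.erase i) fun j hj => by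
          simp [hvi j (Finset.mem_of_mem_erase hj), Finset.ne_of_mem_erase hj]
        have := Finset.card_erase_add_one hi
        omega
      · obtain ⟨v, hv, hv0, hd⟩ := exists_hammingNorm_eq_minDist hC
        -- A word of weight at most `n - k` vanishes on some `k` coordinates, hence is zero.
        by_contra! hlt
        have hc : (Finset.univ.filter fun i => v i ≠ 0).card +
            (Finset.univ.filter fun i => v i ≠ 0)ᶜ.card = n := by
          rw [Finset.card_add_card_compl, Fintype.card_fin]
        have hd' : (Finset.univ.filter fun i => v i ≠ 0).card = minDist C := hd
        obtain ⟨T, hT, hTk⟩ := Finset.exists_subset_card_eq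
          (s := (Finset.univ.filter fun i => v i ≠ 0)ᶜ) (n := k) (by omega)
        exact hv0 ((h T hTk).eq_zero v hv fun i hi => by simpa using hT hi)
    rw [IsMDS, (h S hS).len_eq, hS]
    have : (minDist C : ℚ) + k = n + 1 := by exact_mod_cast key
    push_cast
    field_simp
    linarith

theorem IsMDS.dual [Nontrivial R] [IsArtinianRing R] {C : Submodule R (Fin n → R)}
    (h : IsMDS C) : IsMDS (dual C) := by
  obtain ⟨k, hk, h⟩ := isMDS_iff.1 h
  refine isMDS_iff.2 ⟨n - k, by omega, fun S hS => ?_⟩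
  rw [← compl_compl S]
  refine (h Sᶜ ?_).dual_compl
  rw [Finset.card_compl, Fintype.card_fin]
  omega

/-- A nonzero finitely generated module over an Artinian local ring has a nonzero linear
functional. -/
theorem exists_linearMap_ne_zero [IsLocalRing R] [IsArtinianRing R] (M : Type*) [AddCommGroup M]
    [Module R M] [Module.Finite R M] [Nontrivial M] : ∃ f : M →ₗ[R] R, f ≠ 0 := by
  obtain ⟨N, hN⟩ := IsCoatomic.exists_coatom (Submodule R M)
  obtain ⟨I, hI⟩ := IsAtomic.exists_atom (Submodule R R)
  have hs₁ : IsSimpleModule R (M ⧸ N) := isSimpleModule_iff_isCoatom.2 hN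
  have hs₂ : IsSimpleModule R I := isSimpleModule_iff_isAtom.2 hI
  -- Both the simple quotient of `M` and the minimal ideal `I` are copies of the residue field, so
  -- the quotient embeds in `R`.
  obtain ⟨J₁, hJ₁, ⟨e₁⟩⟩ := isSimpleModule_iff_quot_maximal.1 hs₁
  obtain ⟨J₂, hJ₂, ⟨e₂⟩⟩ := isSimpleModule_iff_quot_maximal.1 hs₂
  obtain rfl : J₁ = J₂ :=
    (IsLocalRing.eq_maximalIdeal hJ₁).trans (IsLocalRing.eq_maximalIdeal hJ₂).symm
  have := hs₁.nontrivial
  obtain ⟨y, hy⟩ := exists_ne (0 : M ⧸ N)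
  obtain ⟨x, rfl⟩ := N.mkQ_surjective y
  refine ⟨I.subtype ∘ₗ (e₁.trans e₂.symm).toLinearMap ∘ₗ N.mkQ, fun h => hy ?_⟩
  simpa using LinearMap.congr_fun h x

/-- Over an Artinian local ring, a code whose double dual has an information set equals its
double dual. -/
theorem IsInformationSet.dual_dual_eq [IsLocalRing R] [IsArtinianRing R]
    {C : Submodule R (Fin n → R)} {S : Finset (Fin n)}
    (h : IsInformationSet (dual (dual C)) S) : dual (dual C) = C := by
  refine le_antisymm ?_ (le_dual_dual C)
  set E := dual (dual C) with hE
  rw [← Submodule.submoduleOf_eq_top]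
  by_contra hne
  have : Nontrivial (E ⧸ C.submoduleOf E) := Submodule.Quotient.nontrivial_iff.2 hne
  obtain ⟨f, hf⟩ := exists_linearMap_ne_zero (R := R) (E ⧸ C.submoduleOf E)
  obtain ⟨u, -, hu⟩ := h.exists_dotProduct (f ∘ₗ (C.submoduleOf E).mkQ)
  have huC : u ∈ dual C := fun w hw => by
    have hw' : (⟨w, le_dual_dual C hw⟩ : E) ∈ C.submoduleOf E := hw
    have := hu ⟨w, le_dual_dual C hw⟩
    rw [← this, LinearMap.comp_apply, Submodule.mkQ_apply,
      (Submodule.Quotient.mk_eq_zero _).2 hw', map_zero]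
  refine hf (LinearMap.ext fun y => ?_)
  obtain ⟨w, rfl⟩ := (C.submoduleOf E).mkQ_surjective y
  have := hu w
  rw [LinearMap.comp_apply] at this
  rw [this, dotProduct_comm]
  exact w.2 u huC

theorem IsMDS.of_dual [IsLocalRing R] [IsArtinianRing R] {C : Submodule R (Fin n → R)}
    (h : IsMDS (LinearCode.dual C)) : IsMDS C := by
  have hdd := h.dual
  obtain ⟨k, hk, hS⟩ := isMDS_iff.1 hdd
  obtain ⟨S, -, hSk⟩ := Finset.exists_subset_card_eq (s := (Finset.univ : Finset (Fin n)))
    (n := k) (by simpa using hk)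
  rwa [(hS S hSk).dual_dual_eq] at hdd

end LinearCode

end

theorem mainTheorem3 {R : Type*} [CommRing R] [IsLocalRing R] [IsArtinianRing R] {n : ℕ}
    (C : Submodule R (Fin n → R)) :
    LinearCode.IsMDS C ↔ LinearCode.IsMDS (LinearCode.dual C) :=
  ⟨LinearCode.IsMDS.dual, LinearCode.IsMDS.of_dual⟩
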